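/- Let $K$ be a field and let $G$ be a finite graph (no loops, no multiple edges, no isolated vertices) on the vertex set $\{x_1,\dots,x_n\}$, $n\ge 2$. Let $I(G)\subset K[x_1,\dots,x_n]$ be its edge ideal, generated by the products $x_ix_j$ with $\{x_i,x_j\}$ an edge of $G$. For $\mathfrak c=(c_1,\dots,c_n)\in(\mathbb Z_{>0})^n$ and $q\ge 1$, let $(I(G)^q)_{\mathfrak c}$ be the ideal generated by the monomials $x_1^{a_1}\cdots x_n^{a_n}\in I(G)^q$ with $a_i\le c_i$ for all $i$, and let $\delta=\delta_{\mathfrak c}(I(G))$ be the largest $q\ge 1$ with $(I(G)^q)_{\mathfrak c}\neq (0)$. Let $\mathcal B(G,\mathfrak c)$ be the minimal set of monomial generators of $(I(G)^{\delta})_{\mathfrak c}$, and let $\mathcal D(G,\mathfrak c)\subset\mathbb Z^n$ be the set of exponent vectors of all monomials dividing some element of $\mathcal B(G,\mathfrak c)$. A polytope $\mathcal P\subset\mathbb R^n$ of dimension $n$ with vertices in $\mathbb Z^n$ is called normal if, for every $N\ge 2$, each point of $N\mathcal P\cap\mathbb Z^n$ is a sum of $N$ points of $\mathcal P\cap\mathbb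 Z^n$; a normal polytope is called pseudo-Gorenstein* if its interior contains exactly one point of $\mathbb Z^n$. The graph $G$ is called labeling pseudo-Gorenstein* if there is $\mathfrak c\in(\mathbb Z_{>0})^n$ such that the convex hull of $\mathcal D(G,\mathfrak c)$ in $\mathbb R^n$ is pseudo-Gorenstein*. **Theorem.** Let $T$ be a tree on $n\ge 2$ vertices. Then the following conditions are equivalent: (i) $T$ is labeling pseudo-Gorenstein*. (ii) If $x$ and $y$ are leaves of $T$ (vertices of degree $1$), then $\operatorname{dist}(x,y)\neq 2$. -/

import Mathlib

open scoped Pointwise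

noncomputable section

/-! ### Lattice polytopes in `ℝ^ι` -/

/-- The lattice `ℤ^ι` inside `ℝ^ι`. -/
def latticePoints (ι : Type*) : Set (ι → ℝ) :=
  Set.range fun (a : ι → ℤ) (i : ι) => (a i : ℝ)

/-- A full-dimensional lattice polytope: the convex hull of a finite set, whose affine span is the
whole space and all of whose vertices (extreme points) are lattice points. -/
def IsLatticePolytope {ι : Type*} (P : Set (ι → ℝ)) : Prop :=
  (∃ s : Set (ι → ℝ), s.Finite ∧ P = convexHull ℝ s) ∧
    affineSpan ℝ P = ⊤ ∧
    P.extremePoints ℝ ⊆ latticePoints ι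

/-- A normal polytope: a full-dimensional lattice polytope `P` such that for `N ≥ 2` each lattice
point of `N P` is a sum of `N` lattice points of `P`. -/
def IsNormalPolytope {ι : Type*} (P : Set (ι → ℝ)) : Prop :=
  IsLatticePolytope P ∧
    ∀ N : ℕ, 2 ≤ N → ∀ a ∈ ((N : ℝ) • P) ∩ latticePoints ι,
      ∃ b : Fin N → (ι → ℝ), (∀ k, b k ∈ P ∩ latticePoints ι) ∧ a = ∑ k, b k

/-- A pseudo-Gorenstein* polytope: a normal polytope with exactly one lattice point in its
interior. -/
def IsPseudoGorensteinStar {ι : Type*} (P : Set (ι → ℝ)) : Prop :=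
  IsNormalPolytope P ∧ (interior P ∩ latticePoints ι).ncard = 1

/-! ### Bounded powers of edge ideals

A monomial of `MvPolynomial V K` is represented by its exponent vector in `V →₀ ℕ`. -/

/-- The edge ideal of `G`, generated by the `x_i x_j` with `{i, j}` an edge of `G`. -/
def edgeIdeal {V : Type*} (K : Type*) [Field K] (G : SimpleGraph V) : Ideal (MvPolynomial V K) :=
  Ideal.span {p | ∃ i j : V, G.Adj i j ∧ p = MvPolynomial.X i * MvPolynomial.X j}

/-- The ideal `I_c` generated by those monomials `x^a ∈ I` for which `a_i ≤ c_i` for all `i`. -/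
def boundedIdeal {V K : Type*} [Field K] (I : Ideal (MvPolynomial V K)) (c : V → ℕ) :
    Ideal (MvPolynomial V K) :=
  Ideal.span {p | ∃ a : V →₀ ℕ, (∀ i, a i ≤ c i) ∧ MvPolynomial.monomial a (1 : K) ∈ I ∧
    p = MvPolynomial.monomial a (1 : K)}

/-- `δ_c(I)`: the biggest `q ≥ 1` with `(I ^ q)_c ≠ 0`. -/
def maxBoundedPower {V K : Type*} [Field K] (I : Ideal (MvPolynomial V K)) (c : V → ℕ) : ℕ :=
  sSup {q : ℕ | 1 ≤ q ∧ boundedIdeal (I ^ q) c ≠ ⊥}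

/-- The minimal set of monomial generators of a monomial ideal (as exponent vectors): the monomials
of the ideal that are minimal with respect to divisibility. -/
def minimalMonomialGenerators {V K : Type*} [Field K] (J : Ideal (MvPolynomial V K)) :
    Set (V →₀ ℕ) :=
  {u | Minimal (fun a : V →₀ ℕ => MvPolynomial.monomial a (1 : K) ∈ J) u}

/-- `B(G, c)`: the minimal monomial generators of `(I(G) ^ δ)_c`, where `δ = δ_c(I(G))`. -/
def topBoundedGenerators {V : Type*} (K : Type*) [Field K] (G : SimpleGraph V) (c : V → ℕ) :
    Set (V →₀ ℕ) :=
  minimalMonomialGenerators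
    (boundedIdeal (edgeIdeal K G ^ maxBoundedPower (edgeIdeal K G) c) c)

/-- `D(G, c) ⊆ ℤ^V`: the exponent vectors of the monomials dividing some element of `B(G, c)`. -/
def boundedPolymatroid {V : Type*} (K : Type*) [Field K] (G : SimpleGraph V) (c : V → ℕ) :
    Set (V → ℤ) :=
  {z | ∃ u ∈ topBoundedGenerators K G c, ∃ a : V →₀ ℕ, a ≤ u ∧ ∀ v, z v = (a v : ℤ)}

/-- `conv(D(G, c)) ⊆ ℝ^V`. -/
def boundedPolytope {V : Type*} (K : Type*) [Field K] (G : SimpleGraph V) (c : V → ℕ) :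
    Set (V → ℝ) :=
  convexHull ℝ ((fun (z : V → ℤ) (v : V) => (z v : ℝ)) '' boundedPolymatroid K G c)

/-- `G` is labeling pseudo-Gorenstein*: `conv(D(G, c))` is pseudo-Gorenstein* for some vector `c` of
positive integers. -/
def IsLabelingPseudoGorensteinStar {V : Type*} (K : Type*) [Field K] (G : SimpleGraph V) : Prop :=
  ∃ c : V → ℕ, (∀ v, 0 < c v) ∧ IsPseudoGorensteinStar (boundedPolytope K G c)

end

/-!
The monomials of `I(G) ^ q` with exponents bounded by `c` correspond to multisets of `q` edges with
degrees bounded by `c`, so the elements of `B(G, c)` are the degree vectors of the maximum edge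
packings.

If two leaves `x`, `y` share their neighbour `z`, every packing satisfies `deg x + deg y ≤ deg z`.
An interior lattice point of the polytope then forces `c x, c y ≥ 2` and `c z ≥ 3`, hence every
maximum packing has degree at least `3` at `z`. So the `z`-coordinate of an interior point can be
changed to `1` and to `2`, and there are at least two interior lattice points.

Otherwise `c = 2` works for a forest `G`. The points `p` of `conv D(G, m)` satisfy Hall's
inequalities `∑_{v ∈ A} p v ≤ m * |N(A)|`. Conversely, a lattice point satisfying those with
`N * m` in place of `m` is dominated by a maximum packing, by Hall's theorem on each side of the
bipartition and the alternating paths of Mendelsohn and Dulmage; since `G` is a forest, this packing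
splits, one pendant edge after the other, into `N` packings for the capacity `m`. This gives
normality. As distinct leaves have distinct neighbours, `|A| < 2 * |N(A)|` for all nonempty `A`,
which puts the vector `(1, …, 1)` in the interior; no other lattice point satisfies `0 < p v < 2`.
-/

open Finset SimpleGraph

section Multisets

variable {α : Type*} [DecidableEq α] {s t : Multiset α} {a : α}

theorem add_sub_comm_multiset (s t : Multiset α) : s + (t - s) = t + (s - t) := by
  ext a
  simp only [Multiset.count_add, Multiset.count_sub]
  omega

theorem sub_erase_of_mem_sub (h : a ∈ t - s) : s - t.erase a = s - t := by
  rw [Multiset.mem_sub] at h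
  ext b
  rw [Multiset.count_sub, Multiset.count_sub]
  obtain rfl | hb := eq_or_ne b a
  · rw [Multiset.count_erase_self]
    omega
  · rw [Multiset.count_erase_of_ne hb]

theorem card_sub_cons_lt (h : a ∈ s - t) : (s - a ::ₘ t).card < (s - t).card := by
  rw [← Multiset.singleton_add, add_comm, Multiset.sub_add_eq_sub_sub, Multiset.sub_singleton]
  exact Multiset.card_erase_lt_of_mem h

end Multisets

noncomputable section EdgeDegree

variable {V : Type*} [DecidableEq V]

/-- The degree vector of a multiset `M` of edges. As a finitely supported function it is also the
exponent vector of the monomial `∏ x_i x_j`, where `{i, j}` runs over `M` with multiplicity. -/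
def edgeDegree : Multiset (Sym2 V) →+ V →₀ ℕ where
  toFun M := Multiset.toFinsupp (M.bind Sym2.toMultiset)
  map_zero' := by simp
  map_add' M N := by simp

theorem edgeDegree_apply (M : Multiset (Sym2 V)) (v : V) :
    edgeDegree M v = (M.bind Sym2.toMultiset).count v := rfl

theorem edgeDegree_cons (x y : V) (M : Multiset (Sym2 V)) :
    edgeDegree (s(x, y) ::ₘ M) = .single x 1 + .single y 1 + edgeDegree M := by
  rw [← Multiset.singleton_add, map_add, ← Multiset.toFinsupp_singleton,
    ← Multiset.toFinsupp_singleton, ← Multiset.toFinsupp_add]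
  have hxy : s(x, y).toMultiset = {x} + {y} := rfl
  simp [edgeDegree, hxy]

theorem edgeDegree_sum_singleton {ι : Type*} (S : Finset ι) (x y : ι → V) (v : V) :
    edgeDegree (∑ p ∈ S, {s(x p, y p)}) v = #{p ∈ S | x p = v} + #{p ∈ S | y p = v} := by
  simp [← Multiset.cons_zero, edgeDegree_cons, sum_add_distrib, Finsupp.single_apply]

theorem edgeDegree_mono : Monotone (edgeDegree (V := V)) := fun M N h => by
  obtain ⟨R, rfl⟩ := Multiset.le_iff_exists_add.1 h
  exact map_add edgeDegree M R ▸ le_self_add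

theorem degree_edgeDegree (M : Multiset (Sym2 V)) : (edgeDegree M).degree = 2 * M.card := by
  induction M using Multiset.induction_on with
  | empty => simp
  | cons e M ih =>
    induction e with
    | _ x y =>
      simp only [edgeDegree_cons, map_add, Finsupp.degree_single, ih, Multiset.card_cons]
      ring

theorem eq_of_edgeDegree_le {M N : Multiset (Sym2 V)} (h : edgeDegree M ≤ edgeDegree N)
    (hcard : N.card = M.card) : edgeDegree M = edgeDegree N := by
  obtain ⟨w, hw⟩ := le_iff_exists_add.1 h
  have hdeg := congrArg Finsupp.degree hw
  rw [map_add, degree_edgeDegree, degree_edgeDegree, hcard, left_eq_add,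
    Finsupp.degree_eq_zero_iff] at hdeg
  rw [hw, hdeg, add_zero]

theorem edgeDegree_pos_iff {M : Multiset (Sym2 V)} {v : V} :
    0 < edgeDegree M v ↔ ∃ e ∈ M, v ∈ e := by
  simp [edgeDegree_apply, Multiset.count_pos]

theorem edgeDegree_add_sub_comm (M N : Multiset (Sym2 V)) :
    edgeDegree M + edgeDegree (N - M) = edgeDegree N + edgeDegree (M - N) := by
  rw [← map_add, ← map_add, add_sub_comm_multiset]

theorem exists_mem_sub_of_edgeDegree_lt {M N : Multiset (Sym2 V)} {v : V}
    (h : edgeDegree M v < edgeDegree N v) : ∃ e ∈ N - M, v ∈ e := by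
  have := DFunLike.congr_fun (edgeDegree_add_sub_comm M N) v
  simp only [Finsupp.add_apply] at this
  exact edgeDegree_pos_iff.1 (by omega)

theorem exists_mem_sub_of_mem_sub {M N : Multiset (Sym2 V)} {v : V} {e : Sym2 V}
    (h : edgeDegree N v ≤ edgeDegree M v) (he : e ∈ N - M) (hve : v ∈ e) :
    ∃ f ∈ M - N, v ∈ f := by
  have hpos := edgeDegree_pos_iff.2 ⟨e, he, hve⟩
  have := DFunLike.congr_fun (edgeDegree_add_sub_comm M N) v
  simp only [Finsupp.add_apply] at this
  exact edgeDegree_pos_iff.1 (by omega)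

theorem edgeDegree_le_of_forall_mem {M : Multiset (Sym2 V)} {v p : V}
    (h : ∀ e ∈ M, v ∈ e → p ∈ e) (hM : ∀ e ∈ M, ¬ e.IsDiag) : edgeDegree M v ≤ edgeDegree M p := by
  induction M using Multiset.induction_on with
  | empty => simp
  | cons e M ih =>
    rw [Multiset.forall_mem_cons] at h hM
    have ih := ih h.2 hM.2
    induction e with
    | _ x y =>
      have hxy : x ≠ y := hM.1
      have hv := h.1
      simp only [edgeDegree_cons, Finsupp.add_apply, Finsupp.single_apply, Sym2.mem_iff] at hv ⊢
      grind

theorem sum_edgeDegree_le {G : SimpleGraph V} [G.LocallyFinite] {M : Multiset (Sym2 V)}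
    (hM : ∀ e ∈ M, e ∈ G.edgeSet) (A : Finset V) :
    ∑ v ∈ A, edgeDegree M v ≤ ∑ u ∈ A.biUnion fun v => G.neighborFinset v, edgeDegree M u := by
  induction M using Multiset.induction_on with
  | empty => simp
  | cons e M ih =>
    rw [Multiset.forall_mem_cons] at hM
    have ih := ih hM.2
    induction e with
    | _ x y =>
      have hxy : G.Adj x y := hM.1
      have hx : y ∈ A → x ∈ A.biUnion fun v => G.neighborFinset v := fun h =>
        mem_biUnion.2 ⟨y, h, by simpa using hxy.symm⟩
      have hy : x ∈ A → y ∈ A.biUnion fun v => G.neighborFinset v := fun h =>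
        mem_biUnion.2 ⟨x, h, by simpa using hxy⟩
      simp only [edgeDegree_cons, Finsupp.add_apply, sum_add_distrib, Finsupp.single_apply,
        sum_ite_eq]
      split_ifs <;> grind

end EdgeDegree

section Packings

variable {V : Type*} [DecidableEq V]

/-- An edge packing of `G` with capacities `c`: a multiset of edges whose degree vector is bounded
by `c`. The packings of size `q` correspond to the generators of `(I(G) ^ q)_c`. -/
structure IsEdgePacking (G : SimpleGraph V) (c : V → ℕ) (M : Multiset (Sym2 V)) : Prop where
  mem_edgeSet : ∀ e ∈ M, e ∈ G.edgeSet
  degree_le : ∀ v, edgeDegree M v ≤ c v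

/-- An edge packing of maximum size. Its size is `δ_c(I(G))`, and the degree vectors of the maximum
packings form `B(G, c)`. -/
structure IsMaxEdgePacking (G : SimpleGraph V) (c : V → ℕ) (M : Multiset (Sym2 V)) : Prop extends
    IsEdgePacking G c M where
  card_le : ∀ N, IsEdgePacking G c N → N.card ≤ M.card

variable {G : SimpleGraph V} {c : V → ℕ} {M N : Multiset (Sym2 V)}

namespace IsEdgePacking

theorem zero : IsEdgePacking G c 0 := ⟨by simp, by simp⟩

theorem mono (hN : IsEdgePacking G c N) (h : M ≤ N) : IsEdgePacking G c M :=
  ⟨fun e he => hN.mem_edgeSet e (Multiset.mem_of_le h he),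
    fun v => (edgeDegree_mono h v).trans (hN.degree_le v)⟩

theorem cons (hM : IsEdgePacking G c M) {x y : V} (hxy : G.Adj x y) (hx : edgeDegree M x < c x)
    (hy : edgeDegree M y < c y) : IsEdgePacking G c (s(x, y) ::ₘ M) := by
  refine ⟨Multiset.forall_mem_cons.2 ⟨hxy, hM.mem_edgeSet⟩, fun v => ?_⟩
  have hv := hM.degree_le v
  have hne := hxy.ne
  simp only [edgeDegree_cons, Finsupp.add_apply, Finsupp.single_apply]
  grind

theorem sum {ι : Type*} {s : Finset ι} {c : ι → V → ℕ} {f : ι → Multiset (Sym2 V)}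
    (hf : ∀ k ∈ s, IsEdgePacking G (c k) (f k)) :
    IsEdgePacking G (∑ k ∈ s, c k) (∑ k ∈ s, f k) := by
  refine ⟨fun e he => ?_, fun v => ?_⟩
  · obtain ⟨k, hk, he⟩ := Multiset.mem_sum.1 he
    exact (hf k hk).mem_edgeSet e he
  · rw [map_sum, Finsupp.finsetSum_apply, Finset.sum_apply]
    exact sum_le_sum fun k hk => (hf k hk).degree_le v

theorem two_mul_card_le [Fintype V] (hM : IsEdgePacking G c M) : 2 * M.card ≤ ∑ v, c v := by
  rw [← degree_edgeDegree, Finsupp.degree_eq_sum]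
  exact sum_le_sum fun v _ => hM.degree_le v

/-- One step along an alternating path: `x` gains the edge `s(x, y)` of `N`, and if this overloads
`y`, then `y` gives up an edge of `M` which is not in `N`. -/
theorem exists_exchange (hM : IsEdgePacking G c M) (hN : IsEdgePacking G c N) {x : V}
    (hx : edgeDegree M x < edgeDegree N x) :
    ∃ M' y, IsEdgePacking G c M' ∧ M.card ≤ M'.card ∧ (N - M').card < (N - M).card ∧
      G.Adj x y ∧ ∀ v, ¬ G.Adj y v → edgeDegree M v ≤ edgeDegree M' v := by
  obtain ⟨e, he, hxe⟩ := exists_mem_sub_of_edgeDegree_lt hx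
  obtain ⟨y, rfl⟩ := Sym2.mem_iff_exists.1 hxe
  have hxy : G.Adj x y := hN.mem_edgeSet _ (Multiset.mem_of_le (Multiset.sub_le_self _ _) he)
  have hxc : edgeDegree M x < c x := hx.trans_le (hN.degree_le x)
  by_cases hyc : edgeDegree M y < c y
  · exact ⟨s(x, y) ::ₘ M, y, hM.cons hxy hxc hyc, by simp, card_sub_cons_lt he, hxy,
      fun v _ => edgeDegree_mono (Multiset.le_cons_self M _) v⟩
  obtain ⟨f, hf, hyf⟩ := exists_mem_sub_of_mem_sub ((hN.degree_le y).trans (not_lt.1 hyc)) he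
    (Sym2.mem_mk_right x y)
  have hfM : f ∈ M := Multiset.mem_of_le (Multiset.sub_le_self _ _) hf
  obtain ⟨z, rfl⟩ := Sym2.mem_iff_exists.1 hyf
  have hyz : G.Adj y z := hM.mem_edgeSet _ hfM
  have hdeg (v : V) : edgeDegree M v = Finsupp.single y 1 v + Finsupp.single z 1 v +
      edgeDegree (M.erase s(y, z)) v := by
    conv_lhs => rw [← Multiset.cons_erase hfM, edgeDegree_cons, Finsupp.add_apply,
      Finsupp.add_apply]
  refine ⟨s(x, y) ::ₘ M.erase s(y, z), y, ?_, ?_, ?_, hxy, fun v hv => ?_⟩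
  · refine (hM.mono (Multiset.erase_le _ _)).cons hxy ?_ ?_
    · exact (edgeDegree_mono (Multiset.erase_le _ _) x).trans_lt hxc
    · have hyM := hM.degree_le y
      rw [hdeg, Finsupp.single_eq_same] at hyM
      omega
  · rw [Multiset.card_cons, Multiset.card_erase_add_one hfM]
  · rw [← sub_erase_of_mem_sub hf] at he ⊢
    exact card_sub_cons_lt he
  · have hzv : Finsupp.single z 1 v = 0 := Finsupp.single_eq_of_ne fun h => hv (h ▸ hyz)
    rw [hdeg, hzv, edgeDegree_cons, Finsupp.add_apply, Finsupp.add_apply]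
    omega

theorem exists_isMaxEdgePacking_le [Finite V] (hM : IsEdgePacking G c M) :
    ∃ N, IsMaxEdgePacking G c N ∧ edgeDegree M ≤ edgeDegree N := by
  cases nonempty_fintype V
  have hbdd : BddAbove (Multiset.card '' {N | IsEdgePacking G c N}) :=
    ⟨∑ v, c v, Set.forall_mem_image.2 fun N hN => by linarith [hN.two_mul_card_le]⟩
  obtain ⟨_, ⟨N₀, hN₀, rfl⟩, hmax⟩ :=
    hbdd.exists_isGreatest_of_nonempty (Set.Nonempty.image _ ⟨M, hM⟩)
  have hex : ∃ N, IsMaxEdgePacking G c N :=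
    ⟨N₀, hN₀, fun L hL => hmax (Set.mem_image_of_mem _ hL)⟩
  obtain ⟨N, hN, hmin⟩ :=
    exists_minimalFor_of_wellFoundedLT _ (fun N => (M - N).card) hex
  refine ⟨N, hN, fun v => ?_⟩
  by_contra! hv
  obtain ⟨N', -, hN', hcard, hlt, -⟩ := hN.exists_exchange hM hv
  exact hlt.not_ge (hmin ⟨hN', fun L hL => (hN.card_le L hL).trans hcard⟩ hlt.le)

/-- The Mendelsohn–Dulmage theorem: among the packings that cover `w` on one colour class, one
closest to a packing that covers `w` on the other class covers `w` everywhere. -/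
theorem exists_le_edgeDegree_of_coloring (C : G.Coloring Bool) {w : V → ℕ}
    (h : ∀ b, ∃ M, IsEdgePacking G c M ∧ ∀ v, C v = b → w v ≤ edgeDegree M v) :
    ∃ M, IsEdgePacking G c M ∧ ∀ v, w v ≤ edgeDegree M v := by
  obtain ⟨N, hN, hNw⟩ := h false
  obtain ⟨M, ⟨hM, hMw⟩, hmin⟩ :=
    exists_minimalFor_of_wellFoundedLT _ (fun M => (N - M).card) (h true)
  refine ⟨M, hM, fun v => ?_⟩
  by_contra! hv
  have hCv : C v = false := by simpa using mt (hMw v) hv.not_ge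
  obtain ⟨M', y, hM', -, hlt, hvy, hdeg⟩ := hM.exists_exchange hN (hv.trans_le (hNw v hCv))
  refine hlt.not_ge (hmin ⟨hM', fun u hu => (hMw u hu).trans (hdeg u fun hyu => ?_)⟩ hlt.le)
  have hCvy := C.valid hvy
  have hCyu := C.valid hyu
  simp_all

end IsEdgePacking

namespace IsMaxEdgePacking

theorem congr_card (hM : IsMaxEdgePacking G c M) (hN : IsEdgePacking G c N)
    (h : M.card = N.card) : IsMaxEdgePacking G c N :=
  ⟨hN, fun L hL => h ▸ hM.card_le L hL⟩

theorem le_edgeDegree_of_lt (hM : IsMaxEdgePacking G c M) {x z : V} (hxz : G.Adj x z)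
    (hz : edgeDegree M z < c z) : c x ≤ edgeDegree M x := by
  by_contra! hx
  simpa using hM.card_le _ (hM.cons hxz hx hz)

theorem of_sum {ι : Type*} [Fintype ι] {c : ι → V → ℕ} {f : ι → Multiset (Sym2 V)}
    (hf : ∀ k, IsEdgePacking G (c k) (f k)) (hmax : IsMaxEdgePacking G (∑ k, c k) (∑ k, f k))
    (k : ι) : IsMaxEdgePacking G (c k) (f k) := by
  classical
  refine ⟨hf k, fun L hL => ?_⟩
  have hsum : IsEdgePacking G (∑ j, c j) (∑ j, Function.update f k L j) := by
    refine .sum fun j _ => ?_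
    obtain rfl | hj := eq_or_ne j k
    · rwa [Function.update_self]
    · rw [Function.update_of_ne hj]
      exact hf j
  have hcard := hmax.card_le _ hsum
  rw [sum_update_of_mem (mem_univ k), ← add_sum_erase univ f (mem_univ k),
    sdiff_singleton_eq_erase, Multiset.card_add, Multiset.card_add] at hcard
  omega

end IsMaxEdgePacking

end Packings

section Hall

theorem exists_injective_of_sum_le_sum_biUnion {ι α : Type*} [DecidableEq α] (t : ι → Finset α)
    (w : ι → ℕ) (c : α → ℕ) (hall : ∀ A : Finset ι, ∑ i ∈ A, w i ≤ ∑ a ∈ A.biUnion t, c a) :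
    ∃ f : (Σ i, Fin (w i)) → Σ a, Fin (c a), f.Injective ∧ ∀ p, (f p).1 ∈ t p.1 := by
  classical
  obtain ⟨f, hf, hft⟩ := (all_card_le_biUnion_card_iff_exists_injective
    fun p : Σ i, Fin (w i) => (t p.1).sigma fun a => (univ : Finset (Fin (c a)))).1 fun S => by
      have hS : S ⊆ (S.image Sigma.fst).sigma fun _ => univ := fun p hp => by
        simpa using ⟨p.2, hp⟩
      have ht : S.biUnion (fun p => (t p.1).sigma fun a => (univ : Finset (Fin (c a)))) =
          ((S.image Sigma.fst).biUnion t).sigma fun _ => univ := by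
        ext ⟨a, j⟩
        simp
      calc S.card ≤ ∑ i ∈ S.image Sigma.fst, w i := by simpa using card_le_card hS
        _ ≤ _ := hall _
        _ = _ := by simp [ht]
  exact ⟨f, hf, fun p => by simpa using hft p⟩

variable {V : Type*} [DecidableEq V]

/-- Hall's condition for covering the demand `w` by edges of `G`, where the vertex `v` can take part
in at most `c v` edges. -/
structure HallCondition (G : SimpleGraph V) [G.LocallyFinite] (c w : V → ℕ) : Prop where
  demand_le : ∀ v, w v ≤ c v
  sum_le : ∀ A : Finset V, ∑ v ∈ A, w v ≤ ∑ u ∈ A.biUnion fun v => G.neighborFinset v, c u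

namespace HallCondition

variable [Finite V] {G : SimpleGraph V} [G.LocallyFinite] {c w : V → ℕ}

theorem exists_isEdgePacking_on_colorClass (h : HallCondition G c w) {α : Type*}
    (C : G.Coloring α) (b : α) :
    ∃ M, IsEdgePacking G c M ∧ ∀ v, C v = b → w v ≤ edgeDegree M v := by
  classical
  cases nonempty_fintype V
  obtain ⟨f, hf, hft⟩ :=
    exists_injective_of_sum_le_sum_biUnion (fun v => G.neighborFinset v) w c h.sum_le
  have hadj (p) : G.Adj p.1 (f p).1 := by simpa using hft p
  let S : Finset (Σ v, Fin (w v)) := {p | C p.1 = b}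
  have hself (v : V) (hv : C v = b) : edgeDegree (∑ p ∈ S, {s(p.1, (f p).1)}) v = w v := by
    have hfst : ({p ∈ S | p.1 = v} : Finset _) = ({v} : Finset V).sigma fun _ => univ := by
      ext ⟨u, j⟩
      simp +contextual [S, hv]
    have hsnd : ({p ∈ S | (f p).1 = v} : Finset _) = ∅ := filter_eq_empty_iff.2 fun p hp hpv =>
      C.valid (hadj p) (by rw [hpv, hv]; simpa [S] using hp)
    rw [edgeDegree_sum_singleton, hfst, hsnd, card_sigma]
    simp
  refine ⟨∑ p ∈ S, {s(p.1, (f p).1)}, ⟨fun e he => ?_, fun v => ?_⟩, fun v hv => (hself v hv).ge⟩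
  · obtain ⟨p, -, he⟩ := Multiset.mem_sum.1 he
    exact Multiset.mem_singleton.1 he ▸ hadj p
  by_cases hv : C v = b
  · exact (hself v hv).trans_le (h.demand_le v)
  have hfst : ({p ∈ S | p.1 = v} : Finset _) = ∅ := filter_eq_empty_iff.2 fun p hp hpv =>
    hv (hpv ▸ by simpa [S] using hp)
  calc edgeDegree (∑ p ∈ S, {s(p.1, (f p).1)}) v = #{p ∈ S | (f p).1 = v} := by
        rw [edgeDegree_sum_singleton, hfst, card_empty, zero_add]
    _ ≤ #(({v} : Finset V).sigma fun u => (univ : Finset (Fin (c u)))) :=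
        card_le_card_of_injOn f (fun p hp => by simpa using (mem_filter.1 hp).2) hf.injOn
    _ = c v := by simp

theorem exists_isMaxEdgePacking (h : HallCondition G c w) (hG : G.IsBipartite) :
    ∃ M, IsMaxEdgePacking G c M ∧ ∀ v, w v ≤ edgeDegree M v := by
  have C : G.Coloring Bool := hG.toColoring (by simp)
  obtain ⟨M, hM, hw⟩ := IsEdgePacking.exists_le_edgeDegree_of_coloring C fun b =>
    h.exists_isEdgePacking_on_colorClass C b
  obtain ⟨N, hN, hMN⟩ := hM.exists_isMaxEdgePacking_le
  exact ⟨N, hN, fun v => (hw v).trans (hMN v)⟩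

end HallCondition

end Hall

section Forests

variable {V : Type*} {G : SimpleGraph V}

/-- A depth function on a forest `G`: choosing a root in each tree of `G`, the distance to the root
is one. The neighbour of `v` of smaller depth, if there is any, is the parent of `v`. -/
structure IsDepth (G : SimpleGraph V) (d : V → ℕ) : Prop where
  adj_cases : ∀ ⦃u v⦄, G.Adj u v → d u = d v + 1 ∨ d v = d u + 1
  parent_unique : ∀ ⦃p q v⦄, G.Adj p v → G.Adj q v → d v = d p + 1 → d v = d q + 1 → p = q

theorem isDepth_dist (hG : G.IsTree) (r : V) : IsDepth G (G.dist r) := by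
  refine ⟨fun u v => hG.dist_eq_dist_add_one_of_adj r, fun p q v hp hq hpd hqd => ?_⟩
  obtain ⟨a, ha⟩ := hG.connected.exists_walk_length_eq_dist r p
  obtain ⟨b, hb⟩ := hG.connected.exists_walk_length_eq_dist r q
  have ha' := (a.concat hp).isPath_of_length_eq_dist (by rw [Walk.length_concat, ha, hpd])
  have hb' := (b.concat hq).isPath_of_length_eq_dist (by rw [Walk.length_concat, hb, hqd])
  have hab := (hG.existsUnique_path r v).unique ha' hb'
  simpa using congrArg Walk.penultimate hab

theorem exists_isDepth (hG : G.IsAcyclic) (r : V) : ∃ d, IsDepth G d ∧ d r = 0 := by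
  have : Nonempty V := ⟨r⟩
  obtain ⟨T, hGT, -, hT⟩ := connected_top.exists_isTree_le_of_le_of_isAcyclic le_top hG
  have hd := isDepth_dist hT r
  exact ⟨T.dist r, ⟨fun u v h => hd.adj_cases (hGT h),
    fun p q v hp hq => hd.parent_unique (hGT hp) (hGT hq)⟩, dist_self⟩

theorem IsDepth.exists_child {d : V → ℕ} (hd : IsDepth G d) {v a b : V} (ha : G.Adj v a)
    (hb : G.Adj v b) (hab : a ≠ b) : ∃ u, G.Adj v u ∧ d u = d v + 1 := by
  by_contra! h
  exact hab (hd.parent_unique ha.symm hb.symm ((hd.adj_cases ha).resolve_right (h a ha))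
    ((hd.adj_cases hb).resolve_right (h b hb)))

theorem exists_pendant_edge (hG : G.IsAcyclic) {M : Multiset (Sym2 V)}
    (hM : ∀ e ∈ M, e ∈ G.edgeSet) (h0 : M ≠ 0) :
    ∃ v p, s(v, p) ∈ M ∧ ∀ e ∈ M, v ∈ e → e = s(v, p) := by
  classical
  obtain ⟨e₀, he₀⟩ := Multiset.exists_mem_of_ne_zero h0
  obtain ⟨r, hr⟩ : ∃ r, r ∈ e₀ := ⟨_, e₀.out_fst_mem⟩
  obtain ⟨d, hd, -⟩ := exists_isDepth hG r
  obtain ⟨v, hv, hmax⟩ := (M.bind Sym2.toMultiset).toFinset.exists_max_image d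
    ⟨r, by simpa using ⟨e₀, he₀, hr⟩⟩
  simp only [Multiset.mem_toFinset, Multiset.mem_bind, Sym2.mem_toMultiset] at hv hmax
  obtain ⟨e, he, hve⟩ := hv
  obtain ⟨p, rfl⟩ := Sym2.mem_iff_exists.1 hve
  have hparent (q : V) (hq : s(v, q) ∈ M) : G.Adj q v ∧ d v = d q + 1 := by
    have hvq : G.Adj v q := hM _ hq
    refine ⟨hvq.symm, (hd.adj_cases hvq).resolve_right fun h => ?_⟩
    have := hmax q ⟨_, hq, Sym2.mem_mk_right v q⟩
    omega
  refine ⟨v, p, he, fun f hf hvf => ?_⟩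
  obtain ⟨q, rfl⟩ := Sym2.mem_iff_exists.1 hvf
  rw [hd.parent_unique (hparent q hf).1 (hparent p he).1 (hparent q hf).2 (hparent p he).2]

theorem exists_isEdgePacking_sum_eq [DecidableEq V] (hG : G.IsAcyclic) (N m : ℕ)
    {M : Multiset (Sym2 V)} (hM : IsEdgePacking G (fun _ => N * m) M) :
    ∃ f : Fin N → Multiset (Sym2 V), ∑ k, f k = M ∧ ∀ k, IsEdgePacking G (fun _ => m) (f k) := by
  induction hcard : M.card generalizing M with
  | zero => exact ⟨0, by simpa using (Multiset.card_eq_zero.1 hcard).symm, fun _ => .zero⟩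
  | succ q ih =>
    have h0 : M ≠ 0 := Multiset.card_pos.1 (by omega)
    obtain ⟨v, p, hvp, hpend⟩ := exists_pendant_edge hG hM.mem_edgeSet h0
    obtain ⟨R, rfl⟩ := Multiset.exists_cons_of_mem hvp
    obtain ⟨f, rfl, hf⟩ := ih (hM.mono (Multiset.le_cons_self _ _)) (by simpa using hcard)
    obtain ⟨k, -, hk⟩ : ∃ k ∈ univ, edgeDegree (f k) p < m := by
      refine exists_lt_of_sum_lt ?_
      have hp := hM.degree_le p
      rw [edgeDegree_cons, map_sum, Finsupp.add_apply, Finsupp.add_apply,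
        Finsupp.finsetSum_apply, Finsupp.single_eq_same] at hp
      simp only [sum_const, card_univ, Fintype.card_fin, smul_eq_mul]
      omega
    have hvk : edgeDegree (f k) v ≤ edgeDegree (f k) p := by
      refine edgeDegree_le_of_forall_mem (fun e he hve => ?_) fun e he =>
        G.not_isDiag_of_mem_edgeSet ((hf k).mem_edgeSet e he)
      have hsum : e ∈ ∑ j, f j := Multiset.mem_sum.2 ⟨k, mem_univ k, he⟩
      exact hpend e (Multiset.mem_cons_of_mem hsum) hve ▸ Sym2.mem_mk_right v p
    refine ⟨f + Pi.single k {s(v, p)}, ?_, fun j => ?_⟩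
    · simp only [Pi.add_apply, sum_add_distrib, sum_pi_single', mem_univ, if_true]
      rw [add_comm, Multiset.singleton_add]
    obtain rfl | hj := eq_or_ne j k
    · rw [Pi.add_apply, Pi.single_eq_same, add_comm, Multiset.singleton_add]
      exact (hf j).cons (hM.mem_edgeSet _ hvp) (hvk.trans_lt hk) hk
    · simpa [hj] using hf j

theorem IsMaxEdgePacking.exists_sum_eq [DecidableEq V] (hG : G.IsAcyclic) {N m : ℕ}
    {M : Multiset (Sym2 V)} (hM : IsMaxEdgePacking G (fun _ => N * m) M) :
    ∃ f : Fin N → Multiset (Sym2 V), ∑ k, f k = M ∧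
      ∀ k, IsMaxEdgePacking G (fun _ => m) (f k) := by
  obtain ⟨f, rfl, hf⟩ := exists_isEdgePacking_sum_eq hG N m hM.toIsEdgePacking
  refine ⟨f, rfl, fun k => .of_sum (c := fun _ _ => m) hf ?_ k⟩
  convert hM using 1
  ext v
  simp

variable [DecidableEq V] [G.LocallyFinite]

theorem card_filter_neighborFinset_eq_singleton_le
    (hleaf : ∀ x y z, G.neighborFinset x = {z} → G.neighborFinset y = {z} → x = y)
    (A : Finset V) [DecidablePred fun v => ∃ z, G.neighborFinset v = {z}] :
    #{v ∈ A | ∃ z, G.neighborFinset v = {z}} ≤ #(A.biUnion fun v => G.neighborFinset v) := by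
  choose! z hz using fun v (h : ∃ z, G.neighborFinset v = {z}) => h
  refine card_le_card_of_injOn z (fun v hv => ?_) fun x hx y hy hxy => ?_
  · obtain ⟨hvA, hv⟩ := mem_filter.1 hv
    exact mem_biUnion.2 ⟨v, hvA, hz v hv ▸ mem_singleton_self _⟩
  · exact hleaf x y (z x) (hz x (mem_filter.1 hx).2) (hxy ▸ hz y (mem_filter.1 hy).2)

theorem IsDepth.card_filter_nontrivial_le {d : V → ℕ} (hd : IsDepth G d) {r : V} (hr : d r = 0)
    (A : Finset V) [DecidablePred fun v => (G.neighborFinset v).Nontrivial] :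
    #{v ∈ A | (G.neighborFinset v).Nontrivial} ≤
      #((A.biUnion fun v => G.neighborFinset v).erase r) := by
  have hchild (v : V) (hv : (G.neighborFinset v).Nontrivial) :
      ∃ u, G.Adj v u ∧ d u = d v + 1 := by
    obtain ⟨a, ha, b, hb, hab⟩ := hv
    exact hd.exists_child (by simpa using ha) (by simpa using hb) hab
  choose! child hadj hdepth using hchild
  refine card_le_card_of_injOn child (fun v hv => ?_) fun x hx y hy hxy => ?_
  · obtain ⟨hvA, hv⟩ := mem_filter.1 hv
    have hne : child v ≠ r := fun h => by have := hdepth v hv; rw [h] at this; omega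
    exact mem_erase.2 ⟨hne, mem_biUnion.2 ⟨v, hvA, by simpa using hadj v hv⟩⟩
  · have hx := (mem_filter.1 hx).2
    have hy := (mem_filter.1 hy).2
    exact hd.parent_unique (hadj x hx) (hxy ▸ hadj y hy) (hdepth x hx) (hxy ▸ hdepth y hy)

/-- The leaves in `A` have distinct neighbours, the other vertices of `A` have distinct children,
and a root adjacent to `A` is nobody's child. -/
theorem card_lt_two_mul_card_biUnion_neighborFinset (hG : G.IsAcyclic)
    (hadj : ∀ v, ∃ u, G.Adj v u)
    (hleaf : ∀ x y z, G.neighborFinset x = {z} → G.neighborFinset y = {z} → x = y)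
    {A : Finset V} (hA : A.Nonempty) : #A < 2 * #(A.biUnion fun v => G.neighborFinset v) := by
  classical
  obtain ⟨a, ha⟩ := hA
  obtain ⟨r, har⟩ := hadj a
  obtain ⟨d, hd, hr⟩ := exists_isDepth hG r
  have hrA : r ∈ A.biUnion fun v => G.neighborFinset v := mem_biUnion.2 ⟨a, ha, by simpa using har⟩
  have hleaves := card_filter_neighborFinset_eq_singleton_le hleaf A
  have hbranch := hd.card_filter_nontrivial_le hr A
  have hsplit : #A ≤ #{v ∈ A | ∃ z, G.neighborFinset v = {z}} +
      #{v ∈ A | (G.neighborFinset v).Nontrivial} := by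
    rw [← card_filter_add_card_filter_not (s := A) fun v => ∃ z, G.neighborFinset v = {z}]
    gcongr with v
    intro h
    obtain ⟨u, hu⟩ := hadj v
    exact Finset.nontrivial_iff_ne_singleton (by simpa using hu) |>.2 fun h' => h ⟨u, h'⟩
  have hcard := card_erase_lt_of_mem hrA
  omega

end Forests

section EdgeIdeals

open MvPolynomial

variable {V : Type*} {K : Type*} [Field K]

theorem monomial_mem_span_monomial_image {S : Set (V →₀ ℕ)} {a : V →₀ ℕ} :
    monomial a (1 : K) ∈ Ideal.span ((fun s => monomial s (1 : K)) '' S) ↔ ∃ s ∈ S, s ≤ a := by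
  classical
  simp [mem_ideal_span_monomial_image, support_monomial]

theorem boundedIdeal_eq_span_image (I : Ideal (MvPolynomial V K)) (c : V → ℕ) :
    boundedIdeal I c = Ideal.span ((fun s => monomial s (1 : K)) ''
      {a | (∀ v, a v ≤ c v) ∧ monomial a (1 : K) ∈ I}) := by
  rw [boundedIdeal]
  congr 1
  ext p
  simp [and_assoc, eq_comm]

variable [DecidableEq V] {G : SimpleGraph V} {c : V → ℕ} {q : ℕ}

variable (K G) in
theorem edgeIdeal_pow (q : ℕ) :
    edgeIdeal K G ^ q = Ideal.span ((fun s => monomial s (1 : K)) ''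
      (edgeDegree '' {M | (∀ e ∈ M, e ∈ G.edgeSet) ∧ M.card = q})) := by
  induction q with
  | zero =>
    have h : {M : Multiset (Sym2 V) | (∀ e ∈ M, e ∈ G.edgeSet) ∧ M.card = 0} = {0} := by
      ext M
      simpa using fun h : M = 0 => by simp [h]
    rw [h]
    simp [Ideal.one_eq_top]
  | succ q ih =>
    have hcons (x y : V) (M : Multiset (Sym2 V)) :
        monomial (edgeDegree (s(x, y) ::ₘ M)) (1 : K) = X x * X y * monomial (edgeDegree M) 1 := by
      simp [edgeDegree_cons, X, monomial_mul]
    rw [pow_succ', ih, edgeIdeal, Ideal.span_mul_span']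
    congr 1
    ext p
    constructor
    · rintro ⟨_, ⟨x, y, hxy, rfl⟩, _, ⟨_, ⟨M, ⟨hM, rfl⟩, rfl⟩, rfl⟩, rfl⟩
      exact ⟨_, ⟨s(x, y) ::ₘ M, ⟨Multiset.forall_mem_cons.2 ⟨hxy, hM⟩, by simp⟩, rfl⟩,
        hcons x y M⟩
    · rintro ⟨_, ⟨M, ⟨hM, hcard⟩, rfl⟩, rfl⟩
      obtain ⟨e, R, rfl, hR⟩ := Multiset.card_eq_succ_iff.1 hcard
      obtain ⟨he, hRG⟩ := Multiset.forall_mem_cons.1 hM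
      induction e with
      | _ x y =>
        exact ⟨_, ⟨x, y, he, rfl⟩, _, ⟨_, ⟨R, ⟨hRG, hR⟩, rfl⟩, rfl⟩,
          (hcons x y R).symm⟩

theorem monomial_mem_edgeIdeal_pow {a : V →₀ ℕ} : monomial a (1 : K) ∈ edgeIdeal K G ^ q ↔
    ∃ M : Multiset (Sym2 V), (∀ e ∈ M, e ∈ G.edgeSet) ∧ M.card = q ∧ edgeDegree M ≤ a := by
  simp [edgeIdeal_pow, monomial_mem_span_monomial_image, and_assoc]

theorem monomial_mem_boundedIdeal {u : V →₀ ℕ} :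
    monomial u (1 : K) ∈ boundedIdeal (edgeIdeal K G ^ q) c ↔
      ∃ M, IsEdgePacking G c M ∧ M.card = q ∧ edgeDegree M ≤ u := by
  rw [boundedIdeal_eq_span_image, monomial_mem_span_monomial_image]
  simp only [monomial_mem_edgeIdeal_pow]
  constructor
  · rintro ⟨a, ⟨hac, M, hM, hq, hMa⟩, hau⟩
    exact ⟨M, ⟨hM, fun v => (hMa v).trans (hac v)⟩, hq, hMa.trans hau⟩
  · rintro ⟨M, hM, hq, hMu⟩
    exact ⟨edgeDegree M, ⟨hM.degree_le, M, hM.mem_edgeSet, hq, le_rfl⟩, hMu⟩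

theorem boundedIdeal_edgeIdeal_pow_ne_bot :
    boundedIdeal (edgeIdeal K G ^ q) c ≠ ⊥ ↔ ∃ M, IsEdgePacking G c M ∧ M.card = q := by
  constructor
  · intro h
    rw [boundedIdeal_eq_span_image, Ne, Ideal.span_eq_bot] at h
    push Not at h
    obtain ⟨_, ⟨a, ⟨hac, ha⟩, rfl⟩, -⟩ := h
    obtain ⟨M, hM, hq, hMa⟩ := monomial_mem_edgeIdeal_pow.1 ha
    exact ⟨M, ⟨hM, fun v => (hMa v).trans (hac v)⟩, hq⟩
  · rintro ⟨M, hM, hq⟩ h0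
    have hmem := monomial_mem_boundedIdeal (K := K).2 ⟨M, hM, hq, le_rfl⟩
    rw [h0, Ideal.mem_bot, monomial_eq_zero] at hmem
    exact one_ne_zero hmem

theorem IsMaxEdgePacking.maxBoundedPower_eq {M : Multiset (Sym2 V)} (hM : IsMaxEdgePacking G c M) :
    maxBoundedPower (edgeIdeal K G) c = M.card := by
  simp only [maxBoundedPower, boundedIdeal_edgeIdeal_pow_ne_bot]
  have hub : M.card ∈ upperBounds {q | 1 ≤ q ∧ ∃ N, IsEdgePacking G c N ∧ N.card = q} := by
    rintro _ ⟨-, N, hN, rfl⟩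
    exact hM.card_le N hN
  refine le_antisymm (csSup_le' hub) ?_
  obtain h0 | hpos := Nat.eq_zero_or_pos M.card
  · exact h0 ▸ Nat.zero_le _
  · exact le_csSup ⟨_, hub⟩ ⟨hpos, M, hM.toIsEdgePacking, rfl⟩

variable [Finite V]

theorem mem_topBoundedGenerators {u : V →₀ ℕ} :
    u ∈ topBoundedGenerators K G c ↔ ∃ M, IsMaxEdgePacking G c M ∧ edgeDegree M = u := by
  obtain ⟨M₀, hM₀, -⟩ := (IsEdgePacking.zero (G := G) (c := c)).exists_isMaxEdgePacking_le
  simp only [topBoundedGenerators, hM₀.maxBoundedPower_eq, minimalMonomialGenerators,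
    monomial_mem_boundedIdeal, Set.mem_ofPred_eq]
  constructor
  · rintro ⟨⟨M, hM, hq, hMu⟩, hmin⟩
    exact ⟨M, hM₀.congr_card hM hq.symm, hMu.antisymm (hmin ⟨M, hM, hq, le_rfl⟩ hMu)⟩
  · rintro ⟨M, hM, rfl⟩
    have hq : M.card = M₀.card := (hM₀.card_le M hM.toIsEdgePacking).antisymm
      (hM.card_le M₀ hM₀.toIsEdgePacking)
    refine ⟨⟨M, hM.toIsEdgePacking, hq, le_rfl⟩, ?_⟩
    rintro a ⟨L, -, hLq, hLa⟩ haM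
    exact eq_of_edgeDegree_le (hLa.trans haM) (hq.trans hLq.symm) ▸ hLa

theorem mem_boundedPolymatroid {z : V → ℤ} :
    z ∈ boundedPolymatroid K G c ↔
      ∃ M, IsMaxEdgePacking G c M ∧ ∀ v, 0 ≤ z v ∧ z v ≤ edgeDegree M v := by
  simp only [boundedPolymatroid, mem_topBoundedGenerators, Set.mem_ofPred_eq]
  constructor
  · rintro ⟨_, ⟨M, hM, rfl⟩, a, ha, hz⟩
    exact ⟨M, hM, fun v => ⟨hz v ▸ Int.natCast_nonneg _, hz v ▸ Int.ofNat_le.2 (ha v)⟩⟩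
  · rintro ⟨M, hM, hz⟩
    exact ⟨_, ⟨M, hM, rfl⟩, Finsupp.equivFunOnFinite.symm fun v => (z v).toNat,
      fun v => Int.toNat_le.2 (hz v).2, fun v => (Int.toNat_of_nonneg (hz v).1).symm⟩

end EdgeIdeals

section BoundedPolytope

theorem lt_of_mem_interior {E : Type*} [AddCommGroup E] [Module ℝ E] [TopologicalSpace E]
    [ContinuousAdd E] [ContinuousSMul ℝ E] {P : Set E} {f : E →L[ℝ] ℝ} (hf : f ≠ 0) {b : ℝ}
    (hb : ∀ p ∈ P, f p ≤ b) {p : E} (hp : p ∈ interior P) : f p < b := by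
  have himage : f '' interior P ⊆ interior (Set.Iic b) :=
    interior_maximal (Set.image_subset_iff.2 fun q hq => hb q (interior_subset hq))
      (f.isOpenMap_of_ne_zero hf _ isOpen_interior)
  rw [interior_Iic] at himage
  exact himage ⟨p, hp, rfl⟩

variable {V : Type*} {K : Type*} [Field K] {G : SimpleGraph V} {c : V → ℕ} {p : V → ℝ}

theorem intCast_mem_boundedPolytope {z : V → ℤ} (hz : z ∈ boundedPolymatroid K G c) :
    (fun v => (z v : ℝ)) ∈ boundedPolytope K G c :=
  subset_convexHull ℝ _ ⟨z, hz, rfl⟩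

theorem boundedPolytope_subset [Finite V] [DecidableEq V] {S : Set (V → ℝ)}
    (hS : Convex ℝ S) (h : ∀ M, IsMaxEdgePacking G c M →
      ∀ p : V → ℝ, (∀ v, 0 ≤ p v ∧ p v ≤ edgeDegree M v) → p ∈ S) :
    boundedPolytope K G c ⊆ S := by
  refine convexHull_min ?_ hS
  rintro _ ⟨z, hz, rfl⟩
  obtain ⟨M, hM, hzM⟩ := mem_boundedPolymatroid.1 hz
  refine h M hM _ fun v => ?_
  beta_reduce
  exact_mod_cast hzM v

theorem nonneg_of_mem_boundedPolytope [Finite V] (hp : p ∈ boundedPolytope K G c) (v : V) :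
    0 ≤ p v := by
  classical
  exact boundedPolytope_subset (convex_halfSpace_ge (LinearMap.proj (R := ℝ) v).isLinear 0)
    (fun _ _ _ h => (h v).1) hp

theorem sum_le_of_mem_boundedPolytope [Finite V] [DecidableEq V] {A : Finset V} {b : ℕ}
    (hb : ∀ M, IsMaxEdgePacking G c M → ∑ v ∈ A, edgeDegree M v ≤ b)
    (hp : p ∈ boundedPolytope K G c) : ∑ v ∈ A, p v ≤ b := by
  have hconvex : Convex ℝ {q : V → ℝ | ∑ v ∈ A, q v ≤ b} := by
    simpa using convex_halfSpace_le (∑ v ∈ A, LinearMap.proj (R := ℝ) v).isLinear (b : ℝ)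
  refine boundedPolytope_subset hconvex (fun M hM q hq => ?_) hp
  calc ∑ v ∈ A, q v ≤ ∑ v ∈ A, (edgeDegree M v : ℝ) := sum_le_sum fun v _ => (hq v).2
    _ ≤ b := by exact_mod_cast hb M hM

theorem pos_of_mem_interior_boundedPolytope [Finite V]
    (hp : p ∈ interior (boundedPolytope K G c)) (v : V) : 0 < p v := by
  have hne : -ContinuousLinearMap.proj (R := ℝ) (φ := fun _ => ℝ) v ≠ 0 :=
    fun h => by simpa using DFunLike.congr_fun h (1 : V → ℝ)
  simpa using lt_of_mem_interior (b := 0) hne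
    (fun q hq => by simpa using nonneg_of_mem_boundedPolytope hq v) hp

theorem sum_lt_of_mem_interior_boundedPolytope [Finite V] [DecidableEq V] {A : Finset V}
    (hA : A.Nonempty) {b : ℕ} (hb : ∀ M, IsMaxEdgePacking G c M → ∑ v ∈ A, edgeDegree M v ≤ b)
    (hp : p ∈ interior (boundedPolytope K G c)) : ∑ v ∈ A, p v < b := by
  have hne : ∑ v ∈ A, ContinuousLinearMap.proj (R := ℝ) (φ := fun _ => ℝ) v ≠ 0 :=
    fun h => hA.card_ne_zero <| by simpa using DFunLike.congr_fun h (1 : V → ℝ)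
  simpa using lt_of_mem_interior hne
    (fun q hq => by simpa using sum_le_of_mem_boundedPolytope hb hq) hp

theorem lt_of_mem_interior_boundedPolytope [Finite V]
    (hp : p ∈ interior (boundedPolytope K G c)) (v : V) : p v < c v := by
  classical
  simpa using sum_lt_of_mem_interior_boundedPolytope (singleton_nonempty v)
    (fun M hM => by simpa using hM.degree_le v) hp

theorem finite_boundedPolymatroid [Finite V] : (boundedPolymatroid K G c).Finite := by
  classical
  have := Fintype.ofFinite V
  refine (Set.finite_Icc (0 : V → ℤ) fun v => (c v : ℤ)).subset fun z hz => ?_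
  obtain ⟨M, hM, hzM⟩ := mem_boundedPolymatroid.1 hz
  exact ⟨fun v => (hzM v).1, fun v => (hzM v).2.trans (Nat.cast_le.2 (hM.degree_le v))⟩

theorem isLatticePolytope_boundedPolytope [Finite V]
    (h : (interior (boundedPolytope K G c)).Nonempty) :
    IsLatticePolytope (boundedPolytope K G c) := by
  have := Fintype.ofFinite V
  refine ⟨⟨_, finite_boundedPolymatroid.image _, rfl⟩,
    (convex_convexHull ℝ _).interior_nonempty_iff_affineSpan_eq_top.1 h,
    extremePoints_convexHull_subset.trans ?_⟩
  rintro _ ⟨z, -, rfl⟩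
  exact ⟨z, rfl⟩

end BoundedPolytope

section Normality

theorem exists_sum_eq_of_le_sum {ι : Type*} (s : Finset ι) (d : ι → ℕ) (w : ℕ)
    (h : w ≤ ∑ k ∈ s, d k) : ∃ b : ι → ℕ, (∀ k, b k ≤ d k) ∧ ∑ k ∈ s, b k = w := by
  classical
  induction s using Finset.induction_on generalizing w with
  | empty => exact ⟨0, fun k => Nat.zero_le _, by simpa using (Nat.le_zero.1 h).symm⟩
  | insert a s ha ih =>
    rw [sum_insert ha] at h
    obtain ⟨b, hb, hsum⟩ := ih (w - d a) (by omega)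
    refine ⟨Function.update b a (min w (d a)), fun k => ?_, ?_⟩
    · rcases eq_or_ne k a with rfl | hk
      · simp
      · simpa [hk] using hb k
    · rw [sum_insert ha, Function.update_self, sum_update_of_notMem ha, hsum]
      omega

variable {V : Type*} [Finite V] {K : Type*} [Field K] {G : SimpleGraph V} {N m : ℕ} {w : V → ℕ}

theorem HallCondition.exists_sum_boundedPolymatroid [DecidableEq V] [G.LocallyFinite]
    (h : HallCondition G (fun _ => N * m) w) (hG : G.IsAcyclic) : ∃ b : Fin N → V → ℤ,
      (∀ k, b k ∈ boundedPolymatroid K G fun _ => m) ∧ ∀ v, ∑ k, b k v = w v := by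
  obtain ⟨_, hM, hw⟩ := h.exists_isMaxEdgePacking hG.isBipartite
  obtain ⟨f, rfl, hf⟩ := hM.exists_sum_eq hG
  choose b hb hsum using fun v => exists_sum_eq_of_le_sum univ (fun k => edgeDegree (f k) v) (w v)
    (by simpa using hw v)
  exact ⟨fun k v => b v k, fun k => mem_boundedPolymatroid.2 ⟨f k, hf k, fun v =>
    ⟨Int.natCast_nonneg _, Int.ofNat_le.2 (hb v k)⟩⟩, fun v => by simp [← hsum v]⟩

theorem HallCondition.div_mem_boundedPolytope [DecidableEq V] [G.LocallyFinite]
    (h : HallCondition G (fun _ => N * m) w) (hG : G.IsAcyclic) (hN : N ≠ 0) :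
    (fun v => (w v / N : ℝ)) ∈ boundedPolytope K G fun _ => m := by
  obtain ⟨b, hb, hbw⟩ := h.exists_sum_boundedPolymatroid (K := K) hG
  have hmean : (fun v => (w v / N : ℝ)) = ∑ k, (1 / N : ℝ) • fun v => (b k v : ℝ) := by
    ext v
    have hbwv : ∑ k, (b k v : ℝ) = w v := by exact_mod_cast hbw v
    simp only [Finset.sum_apply, Pi.smul_apply, smul_eq_mul, ← mul_sum, hbwv]
    ring
  rw [hmean]
  exact (convex_convexHull ℝ _).sum_mem (fun _ _ => by positivity) (by simp [hN])
    fun k _ => intCast_mem_boundedPolytope (hb k)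

theorem hallCondition_of_mem_smul_boundedPolytope [DecidableEq V] [G.LocallyFinite]
    {c : V → ℕ}
    (hw : (fun v => (w v : ℝ)) ∈ (N : ℝ) • boundedPolytope K G c) :
    HallCondition G (fun v => N * c v) w := by
  obtain ⟨p, hp, hpw⟩ := hw
  have hsum {A : Finset V} {b : ℕ}
      (hb : ∀ M, IsMaxEdgePacking G c M → ∑ v ∈ A, edgeDegree M v ≤ b) :
      ∑ v ∈ A, w v ≤ N * b := by
    have hreal : ∑ v ∈ A, (w v : ℝ) ≤ N * b := calc
      ∑ v ∈ A, (w v : ℝ) = N * ∑ v ∈ A, p v := by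
        rw [mul_sum]
        exact sum_congr rfl fun v _ => (congrFun hpw v).symm
      _ ≤ N * b := by gcongr; exact sum_le_of_mem_boundedPolytope hb hp
    exact_mod_cast hreal
  refine ⟨fun v => by simpa using hsum (A := {v}) fun M hM => by simpa using hM.degree_le v,
    fun A => ?_⟩
  rw [← mul_sum]
  exact hsum fun M hM =>
    (sum_edgeDegree_le hM.mem_edgeSet A).trans (sum_le_sum fun u _ => hM.degree_le u)

theorem isNormalPolytope_boundedPolytope (hG : G.IsAcyclic)
    (h : (interior (boundedPolytope K G fun _ => m)).Nonempty) :
    IsNormalPolytope (boundedPolytope K G fun _ => m) := by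
  classical
  have := Fintype.ofFinite V
  refine ⟨isLatticePolytope_boundedPolytope h, ?_⟩
  rintro N - _ ⟨hz, z, rfl⟩
  have hz0 (v : V) : 0 ≤ z v := by
    obtain ⟨p, hp, hpz⟩ := hz
    have hzv : (N : ℝ) * p v = z v := congrFun hpz v
    have : (0 : ℝ) ≤ z v := hzv ▸ mul_nonneg N.cast_nonneg (nonneg_of_mem_boundedPolytope hp v)
    exact_mod_cast this
  lift z to V → ℕ using hz0
  obtain ⟨b, hb, hbz⟩ :=
    (hallCondition_of_mem_smul_boundedPolytope (by simpa using hz)).exists_sum_boundedPolymatroid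
      (K := K) hG
  refine ⟨fun k v => b k v, fun k => ⟨intCast_mem_boundedPolytope (hb k), b k, rfl⟩, ?_⟩
  ext v
  rw [Finset.sum_apply]
  beta_reduce
  exact_mod_cast (hbz v).symm

end Normality

section ConstantTwo

variable {V : Type*} [DecidableEq V] {K : Type*} [Field K] {G : SimpleGraph V} [G.LocallyFinite]

theorem hallCondition_of_card_lt_two_mul [Fintype V] {N : ℕ} (hVN : Fintype.card V < N)
    (hN : ∀ A : Finset V, A.Nonempty → #A < 2 * #(A.biUnion fun v => G.neighborFinset v))
    {w : V → ℕ} (hw : ∀ v, w v ≤ N + 1) : HallCondition G (fun _ => N * 2) w := by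
  refine ⟨fun v => (hw v).trans (by omega), fun A => ?_⟩
  obtain rfl | hA := A.eq_empty_or_nonempty
  · simp
  calc ∑ v ∈ A, w v ≤ #A * (N + 1) := sum_le_card_nsmul A w _ fun v _ => hw v
    _ ≤ N * (#A + 1) := by linarith [A.card_le_univ]
    _ ≤ N * (2 * #(A.biUnion fun v => G.neighborFinset v)) := by gcongr; exact hN A hA
    _ = ∑ u ∈ A.biUnion fun v => G.neighborFinset v, N * 2 := by
      rw [sum_const, smul_eq_mul]
      ring

variable [Finite V]

theorem one_mem_interior_boundedPolytope (hG : G.IsAcyclic)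
    (hN : ∀ A : Finset V, A.Nonempty → #A < 2 * #(A.biUnion fun v => G.neighborFinset v)) :
    1 ∈ interior (boundedPolytope K G fun _ => 2) := by
  have := Fintype.ofFinite V
  obtain ⟨N, hVN⟩ := exists_gt (Fintype.card V)
  have hN0 : (0 : ℝ) < N := by exact_mod_cast hVN.pos
  have ht : (1 : ℝ) < (N + 1 : ℕ) / N := by
    rw [one_lt_div hN0]
    exact_mod_cast N.lt_succ_self
  have hbox : Set.univ.pi (fun _ : V => Set.Icc 0 ((N + 1 : ℕ) / N : ℝ)) ⊆
      boundedPolytope K G fun _ => 2 := by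
    have hIcc : Set.Icc 0 ((N + 1 : ℕ) / N : ℝ) = convexHull ℝ {0, ((N + 1 : ℕ) / N : ℝ)} := by
      rw [convexHull_pair, segment_eq_Icc (by positivity)]
    rw [hIcc, ← convexHull_pi]
    refine convexHull_min (fun p hp => ?_) (convex_convexHull ℝ _)
    have hcorner (v : V) : ∃ k ≤ N + 1, p v = (k / N : ℝ) := by
      obtain h | h := hp v (Set.mem_univ v)
      · exact ⟨0, by simp, by simpa using h⟩
      · exact ⟨N + 1, le_rfl, h⟩
    choose w hw hpw using hcorner
    rw [funext hpw]
    exact (hallCondition_of_card_lt_two_mul hVN hN hw).div_mem_boundedPolytope hG hVN.ne_bot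
  exact mem_interior_iff_mem_nhds.2 <| Filter.mem_of_superset
    (set_pi_mem_nhds Set.finite_univ fun v _ => Icc_mem_nhds one_pos ht) hbox

theorem isPseudoGorensteinStar_boundedPolytope (hG : G.IsAcyclic)
    (hN : ∀ A : Finset V, A.Nonempty → #A < 2 * #(A.biUnion fun v => G.neighborFinset v)) :
    IsPseudoGorensteinStar (boundedPolytope K G fun _ => 2) := by
  have h1 := one_mem_interior_boundedPolytope (K := K) hG hN
  refine ⟨isNormalPolytope_boundedPolytope hG ⟨_, h1⟩, Set.ncard_eq_one.2 ⟨1, ?_⟩⟩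
  refine Set.eq_singleton_iff_unique_mem.2 ⟨⟨h1, 1, by ext; simp⟩, ?_⟩
  rintro _ ⟨hz, z, rfl⟩
  beta_reduce at hz ⊢
  ext v
  have hpos : 0 < z v := by exact_mod_cast pos_of_mem_interior_boundedPolytope hz v
  have hlt : z v < 2 := by exact_mod_cast lt_of_mem_interior_boundedPolytope hz v
  have : z v = 1 := by omega
  simp [this]

end ConstantTwo

section SharedNeighbor

theorem convex_setOf_update_mem {V : Type*} [DecidableEq V] {P : Set (V → ℝ)} (hP : Convex ℝ P)
    (z : V) (t : ℝ) : Convex ℝ {p | Function.update p z t ∈ P} := by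
  intro p hp q hq a b ha hb hab
  have hupdate : Function.update (a • p + b • q) z t =
      a • Function.update p z t + b • Function.update q z t := by
    rw [← Function.update_smul, ← Function.update_smul, ← Function.update_add, ← add_smul, hab,
      one_smul]
  rw [Set.mem_ofPred_eq, hupdate]
  exact hP hp hq ha hb hab

variable {V : Type*} {K : Type*} [Field K] {G : SimpleGraph V} {c : V → ℕ} [DecidableEq V]

theorem update_mem_boundedPolytope [Finite V] {z : V} {m : ℕ}
    (hm : ∀ M, IsMaxEdgePacking G c M → m ≤ edgeDegree M z) {p : V → ℝ}
    (hp : p ∈ boundedPolytope K G c) {t : ℝ} (ht : t ∈ Set.Icc (0 : ℝ) m) :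
    Function.update p z t ∈ boundedPolytope K G c := by
  refine convexHull_min ?_ (convex_setOf_update_mem (convex_convexHull ℝ _) z t) hp
  rintro _ ⟨x, hx, rfl⟩
  obtain ⟨M, hM, hxM⟩ := mem_boundedPolymatroid.1 hx
  have hend (k : ℕ) (hk : k ≤ m) :
      Function.update (fun v => (x v : ℝ)) z k ∈ boundedPolytope K G c := by
    convert intCast_mem_boundedPolytope (K := K) (c := c) (z := Function.update x z k)
      (mem_boundedPolymatroid.2 ⟨M, hM, fun v => ?_⟩) using 1
    · ext v
      rcases eq_or_ne v z with rfl | hv <;> simp [*]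
    · rcases eq_or_ne v z with rfl | hv
      · simpa using hk.trans (hm M hM)
      · simpa [hv] using hxM v
  have hsegment := (convex_convexHull ℝ _).segment_subset (hend 0 m.zero_le) (hend m le_rfl)
  rw [← Pi.image_update_segment, segment_eq_Icc (by simp)] at hsegment
  exact hsegment ⟨t, by simpa using ht, rfl⟩

theorem update_mem_interior_boundedPolytope [Finite V] {z : V} {m : ℕ}
    (hm : ∀ M, IsMaxEdgePacking G c M → m ≤ edgeDegree M z) {p : V → ℝ}
    (hp : p ∈ interior (boundedPolytope K G c)) {t : ℝ} (ht : t ∈ Set.Ioo (0 : ℝ) m) :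
    Function.update p z t ∈ interior (boundedPolytope K G c) := by
  have hopen : IsOpen {q : V → ℝ | Function.update q z (p z) ∈ interior (boundedPolytope K G c) ∧
      q z ∈ Set.Ioo (0 : ℝ) m} :=
    (isOpen_interior.preimage (continuous_id.update z continuous_const)).inter
      (isOpen_Ioo.preimage (continuous_apply z))
  refine interior_maximal (fun q hq => ?_) hopen ⟨by simpa using hp, by simpa using ht⟩
  simpa using update_mem_boundedPolytope hm (interior_subset hq.1) (Set.Ioo_subset_Icc_self hq.2)

theorem ncard_interior_inter_latticePoints_ne_one [Finite V] {z : V}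
    (hz : ∀ M, IsMaxEdgePacking G c M → 3 ≤ edgeDegree M z) :
    (interior (boundedPolytope K G c) ∩ latticePoints V).ncard ≠ 1 := by
  intro hcard
  obtain ⟨p, hp⟩ := Set.ncard_eq_one.1 hcard
  obtain ⟨hpP, a, ha⟩ := hp.ge rfl
  have heq (k : ℕ) (hk : 0 < k) (hk3 : k < 3) : p z = k := by
    have hmem : Function.update p z (k : ℝ) ∈
        interior (boundedPolytope K G c) ∩ latticePoints V := by
      refine ⟨update_mem_interior_boundedPolytope hz hpP ⟨by simpa, by exact_mod_cast hk3⟩,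
        Function.update a z k, ?_⟩
      subst ha
      ext v
      rcases eq_or_ne v z with rfl | hv <;> simp [*]
    rw [hp, Set.mem_singleton_iff] at hmem
    simpa using (congrFun hmem z).symm
  have h12 : ((1 : ℕ) : ℝ) = (2 : ℕ) :=
    (heq 1 one_pos (by norm_num)).symm.trans (heq 2 two_pos (by norm_num))
  norm_num at h12

variable [G.LocallyFinite] {x y z : V}

theorem edgeDegree_add_le_of_neighborFinset_eq_singleton {M : Multiset (Sym2 V)}
    (hM : ∀ e ∈ M, e ∈ G.edgeSet) (hxy : x ≠ y) (hx : G.neighborFinset x = {z})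
    (hy : G.neighborFinset y = {z}) : edgeDegree M x + edgeDegree M y ≤ edgeDegree M z := by
  have hbiUnion : ({x, y} : Finset V).biUnion (fun v => G.neighborFinset v) = {z} := by
    simp [biUnion_insert, hx, hy]
  simpa [hbiUnion, sum_pair hxy] using sum_edgeDegree_le hM {x, y}

theorem IsMaxEdgePacking.min_le_edgeDegree {M : Multiset (Sym2 V)} (hM : IsMaxEdgePacking G c M)
    (hxy : x ≠ y) (hx : G.neighborFinset x = {z}) (hy : G.neighborFinset y = {z}) :
    min (c x + c y) (c z) ≤ edgeDegree M z := by
  have hxz : G.Adj x z := by simp [← mem_neighborFinset, hx]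
  have hyz : G.Adj y z := by simp [← mem_neighborFinset, hy]
  obtain hz | hz := le_or_gt (c z) (edgeDegree M z)
  · exact (min_le_right _ _).trans hz
  · calc min (c x + c y) (c z) ≤ c x + c y := min_le_left _ _
      _ ≤ edgeDegree M x + edgeDegree M y :=
        add_le_add (hM.le_edgeDegree_of_lt hxz hz) (hM.le_edgeDegree_of_lt hyz hz)
      _ ≤ edgeDegree M z :=
        edgeDegree_add_le_of_neighborFinset_eq_singleton hM.mem_edgeSet hxy hx hy

end SharedNeighbor

section LeafCondition

variable {V : Type*} {G : SimpleGraph V} [G.LocallyFinite]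

theorem IsLabelingPseudoGorensteinStar.eq_of_neighborFinset_eq_singleton [Finite V]
    {K : Type*} [Field K] {x y z : V}
    (h : IsLabelingPseudoGorensteinStar K G) (hx : G.neighborFinset x = {z})
    (hy : G.neighborFinset y = {z}) : x = y := by
  classical
  by_contra hxy
  obtain ⟨c, -, -, hcard⟩ := h
  obtain ⟨_, hp⟩ := Set.ncard_eq_one.1 hcard
  obtain ⟨hpP, a, rfl⟩ := hp.ge rfl
  beta_reduce at hpP
  have hpos (v : V) : 0 < a v := by exact_mod_cast pos_of_mem_interior_boundedPolytope hpP v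
  have hlt (v : V) : a v < c v := by exact_mod_cast lt_of_mem_interior_boundedPolytope hpP v
  have hsum : a x + a y < c z := by
    have := sum_lt_of_mem_interior_boundedPolytope (A := {x, y}) (insert_nonempty _ _)
      (fun M hM => (sum_pair hxy).trans_le <| (edgeDegree_add_le_of_neighborFinset_eq_singleton
        hM.mem_edgeSet hxy hx hy).trans (hM.degree_le z)) hpP
    rw [sum_pair hxy] at this
    exact_mod_cast this
  refine ncard_interior_inter_latticePoints_ne_one (z := z) (fun M hM => ?_) hcard
  have hdeg := hM.min_le_edgeDegree hxy hx hy
  have := hpos x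
  have := hpos y
  have := hlt x
  have := hlt y
  omega

theorem forall_dist_ne_two_iff :
    (∀ x y, G.degree x = 1 → G.degree y = 1 → G.dist x y ≠ 2) ↔
      ∀ x y z, G.neighborFinset x = {z} → G.neighborFinset y = {z} → x = y := by
  classical
  have hdist (x y : V) : G.dist x y = 2 ↔
      x ≠ y ∧ ¬ G.Adj x y ∧ (G.commonNeighbors x y).Nonempty := by
    rw [SimpleGraph.dist, ENat.toNat_eq_iff two_ne_zero]
    exact edist_eq_two_iff
  simp only [← card_neighborFinset_eq_degree, Finset.card_eq_one, Ne, hdist]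
  constructor
  · intro h x y z hx hy
    have hN {u : V} : G.Adj x u ↔ u = z := by rw [← mem_neighborFinset, hx, mem_singleton]
    have hN' {u : V} : G.Adj y u ↔ u = z := by rw [← mem_neighborFinset, hy, mem_singleton]
    by_contra hxy
    exact h x y ⟨z, hx⟩ ⟨z, hy⟩ ⟨hxy, fun hadj => G.irrefl (hN'.2 (hN.1 hadj)),
      z, hN.2 rfl, hN'.2 rfl⟩
  · rintro h x y ⟨z, hx⟩ ⟨z', hy⟩ ⟨hxy, -, u, hu, hu'⟩
    obtain rfl : u = z := by rwa [← mem_singleton, ← hx, mem_neighborFinset]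
    obtain rfl : u = z' := by rwa [← mem_singleton, ← hy, mem_neighborFinset]
    exact hxy (h x y u hx hy)

end LeafCondition

theorem theorem4p3_general {V : Type*} [Fintype V] (K : Type*) [Field K] (F : SimpleGraph V)
    [DecidableRel F.Adj] (hF : F.IsAcyclic) (hF' : ∀ v, ∃ u, F.Adj v u) :
    IsLabelingPseudoGorensteinStar K F ↔
      ∀ x y : V, F.degree x = 1 → F.degree y = 1 → F.dist x y ≠ 2 := by
  classical
  rw [forall_dist_ne_two_iff]
  exact ⟨fun h _ _ _ => h.eq_of_neighborFinset_eq_singleton, fun h => ⟨fun _ => 2,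
    fun _ => two_pos, isPseudoGorensteinStar_boundedPolytope hF fun _ =>
      card_lt_two_mul_card_biUnion_neighborFinset hF hF' h⟩⟩

theorem theorem4p3 {V : Type*} [Fintype V] (K : Type*) [Field K]
    (T : SimpleGraph V) [DecidableRel T.Adj] (hT : T.IsTree) (hn : 2 ≤ Fintype.card V) :
    IsLabelingPseudoGorensteinStar K T ↔
      ∀ x y : V, T.degree x = 1 → T.degree y = 1 → T.dist x y ≠ 2 := by
  have : Nontrivial V := Fintype.one_lt_card_iff_nontrivial.1 hn
  exact theorem4p3_general K T hT.isAcyclic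
    fun v => hT.connected.preconnected.exists_adj_of_nontrivial v
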